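/- Let $d\ge 1$ and let $Y\subset\mathbb R^d$ be a nonempty, at most countable set. Write $\langle\cdot,\cdot\rangle$ for the standard scalar product on $\mathbb R^d$, and let $$\langle Y\rangle=\prod_{j=1}^{d}\Bigl\{\sum_{k=1}^n z_k y_k^{(j)}:\ n\in\mathbb N,\ z_k\in\mathbb Z,\ y_k\in Y\Bigr\}\subset\mathbb R^d ,$$ where $y^{(j)}$ is the $j$-th coordinate of $y$. Let $q_y\in\mathbb C$ $(y\in Y)$ satisfy $\sum_{y\in Y}|q_y|<\infty$, and let $h:\mathbb R^d\to\mathbb C$ be given by $$h(t)=\sum_{y\in Y}q_y e^{i\langle t,y\rangle},\qquad t\in\mathbb R^d .$$ Assume that $h(0)=\sum_{y\in Y}q_y=1$ and that $\inf_{t\in\mathbb R^d}|h(t)|>0$. Then there exist $\gamma\in\langle Y\rangle$ and complex numbers $\lambda_u$ $(u\in\langle Y\rangle\setminus\{0\})$ with $\sum_{u\in\langle Y\rangle\setminus\{0\}}|\lambda_u|<\infty$ such that $$h(t)=\exp\Bigl\{i\langle t,\gamma\rangle+\sum_{u\in\langle Y\rangle\setminus\{0\}}\lambda_u\bigl(e^{i\langle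 t,u\rangle}-1\bigr)\Bigr\},\qquad t\in\mathbb R^d .$$ -/

import Mathlib

/-- The set `⟨Y⟩ ⊆ ℝ^d` of all finite `ℤ^d`-linear combinations (coordinatewise multiplication) of
elements of `Y`: the Cartesian product, over the coordinates `j`, of the additive groups of all
finite integer combinations of the `j`-th coordinates of points of `Y`. -/
def coordSpan {d : ℕ} (Y : Set (EuclideanSpace ℝ (Fin d))) : Set (EuclideanSpace ℝ (Fin d)) :=
  {u | ∀ j : Fin d, u j ∈ Submodule.span ℤ ((fun y : EuclideanSpace ℝ (Fin d) => y j) '' Y)}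

/-!
Let `G` be the discrete group `coordSpan Y`. The function `h` is the restriction, to the characters
`e_t : u ↦ exp (i ⟨t, u⟩)`, of the Gelfand transform `f` on the dual group of an element of the
convolution algebra `ℓ¹(G)`, and the theorem asserts that `f` is a character `χ ↦ χ γ` times the
exponential of another such transform `g`. Evaluating at `t = 0` gives `exp (g 1) = 1`, so that `g`
may be replaced by `g - g 1`, which turns each `e^{i⟨t, u⟩}` into `e^{i⟨t, u⟩} - 1`.

The characters `e_t` form a group `D` that takes the value `-1` at every nonzero `u`. This alone
makes the coefficients of a trigonometric polynomial bounded by its supremum over `D`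
(`FourierBound.norm_coeff_le`). Since the number of frequencies of `p ^ n` grows polynomially in
`n`, the norm of `p ^ n` in `ℓ¹(G)` is at most a polynomial in `n` times the `n`-th power of the
supremum, so the spectral radius in `ℓ¹(G)` is at most the supremum over `D`
(`FourierBound.exists_summable_pow`). Two consequences follow: suprema over `D` and over the whole
dual group agree, so that a transform bounded away from zero on `D` vanishes nowhere (Kronecker's
theorem, `FourierBound.ne_zero_of_forall_mem`); and if `|f - 1| ≤ s < 1` on `D`, the logarithmic
series gives a logarithm of `f` in `ℓ¹(G)` (`FourierBound.exists_exp_eq_one_add`).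

It remains to bring `f` close to `1`. Approximate `f` in norm by a trigonometric polynomial `p`. The
frequencies of `p` generate a free group of finite rank, whose dual is a torus, and `p` does not
vanish there. Lifting through the covering `exp` shows that on the torus `p` is a monomial times the
exponential of a continuous function (`UnitAddTorus.exists_eq_mFourier_mul_exp`); by
Stone–Weierstrass that function is uniformly close to a trigonometric polynomial `g₁`. With `γ` the
exponent of the monomial, `f / (χ γ * exp g₁)` is within `2 / 3` of `1` on `D`, and its logarithm is
the missing correction (`FourierBound.exists_eq_char_mul_exp`).
-/

/-! ### Absolutely convergent Fourier series on the dual of a discrete group -/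

/-- `FourierBound M f` says that the function `f` on the dual of the discrete group `G` is given by
an absolutely convergent Fourier series `∑ u, c u * χ u` with `∑ u, ‖c u‖ ≤ M`; that is, `f` is the
Gelfand transform of an element of norm at most `M` of the convolution algebra `ℓ¹(G)`. -/
def FourierBound {G : Type*} [AddCommGroup G] (M : ℝ) (f : AddChar G Circle → ℂ) : Prop :=
  ∃ c : G → ℂ, Summable (fun u => ‖c u‖) ∧ ∑' u, ‖c u‖ ≤ M ∧ ∀ χ, f χ = ∑' u, c u * (χ u : ℂ)

namespace FourierBound

variable {G H : Type*} [AddCommGroup G] [AddCommGroup H] {M N s δ : ℝ}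
  {f g : AddChar G Circle → ℂ}

theorem summable_norm_mul_char {ι : Type*} {c : ι → ℂ} (hc : Summable fun i => ‖c i‖)
    (z : ι → Circle) : Summable fun i => ‖c i * (z i : ℂ)‖ := by
  simpa [Circle.norm_coe] using hc

/-- Frequencies may be repeated: a series indexed by any family of frequencies can be collapsed to
one indexed by `G`. -/
theorem of_family {ι : Type*} (c : ι → ℂ) (u : ι → G) (hc : Summable fun i => ‖c i‖)
    (hM : ∑' i, ‖c i‖ ≤ M) (hf : ∀ χ, f χ = ∑' i, c i * (χ (u i) : ℂ)) : FourierBound M f := by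
  have hfib : HasSum (fun v => ∑' i : u ⁻¹' {v}, ‖c i‖) (∑' i, ‖c i‖) := hc.hasSum.tsum_fiberwise u
  have hle : ∀ v, ‖∑' i : u ⁻¹' {v}, c i‖ ≤ ∑' i : u ⁻¹' {v}, ‖c i‖ := fun v =>
    norm_tsum_le_tsum_norm (hc.subtype _)
  have hs : Summable fun v => ‖∑' i : u ⁻¹' {v}, c i‖ :=
    Summable.of_nonneg_of_le (fun _ => norm_nonneg _) hle hfib.summable
  refine ⟨fun v => ∑' i : u ⁻¹' {v}, c i, hs, ?_, fun χ => ?_⟩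
  · exact (hs.tsum_le_tsum hle hfib.summable).trans (hfib.tsum_eq.le.trans hM)
  · have := (summable_norm_mul_char hc fun i => χ (u i)).of_norm.hasSum.tsum_fiberwise u
    rw [hf, ← this.tsum_eq]
    refine tsum_congr fun v => ?_
    rw [← tsum_mul_right]
    exact tsum_congr fun i => by rw [i.2]

theorem mono (hf : FourierBound M f) (h : M ≤ N) : FourierBound N f := by
  obtain ⟨c, hc, hM, e⟩ := hf
  exact ⟨c, hc, hM.trans h, e⟩

theorem norm_le (hf : FourierBound M f) (χ : AddChar G Circle) : ‖f χ‖ ≤ M := by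
  obtain ⟨c, hc, hM, e⟩ := hf
  rw [e]
  refine (norm_tsum_le_tsum_norm (summable_norm_mul_char hc _)).trans (le_trans (le_of_eq ?_) hM)
  simp [Circle.norm_coe]

theorem nonneg (hf : FourierBound M f) : 0 ≤ M := (norm_nonneg _).trans (hf.norm_le 1)

theorem monomial (a : ℂ) (u : G) :
    FourierBound ‖a‖ (fun χ : AddChar G Circle => a * (χ u : ℂ)) :=
  of_family (fun _ : Unit => a) (fun _ => u) (Summable.of_finite) (by simp) (by simp)

theorem const (a : ℂ) : FourierBound ‖a‖ (fun _ : AddChar G Circle => a) := by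
  simpa using monomial (G := G) a 0

/-- Completeness of `ℓ¹(G)`. -/
theorem tsum {ι : Type*} {F : ι → AddChar G Circle → ℂ} {B : ι → ℝ}
    (hF : ∀ i, FourierBound (B i) (F i)) (hB : Summable B) :
    FourierBound (∑' i, B i) (fun χ => ∑' i, F i χ) := by
  have hB0 := fun i => (hF i).nonneg
  choose c hc hM e using hF
  have hs : Summable fun p : ι × G => ‖c p.1 p.2‖ := by
    rw [summable_prod_of_nonneg fun _ => norm_nonneg _]
    exact ⟨hc, Summable.of_nonneg_of_le (fun i => tsum_nonneg fun _ => norm_nonneg _) hM hB⟩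
  refine of_family (fun p : ι × G => c p.1 p.2) (fun p => p.2) hs ?_ fun χ => ?_
  · rw [hs.tsum_prod' hc]
    exact Summable.tsum_le_tsum hM hs.prod hB
  · have := (summable_norm_mul_char hs fun p => χ p.2).of_norm
    rw [this.tsum_prod' fun i => (summable_norm_mul_char (hc i) fun v => χ v).of_norm]
    exact tsum_congr fun i => e i χ

theorem sum {ι : Type*} (s : Finset ι) {F : ι → AddChar G Circle → ℂ} {B : ι → ℝ}
    (hF : ∀ i ∈ s, FourierBound (B i) (F i)) :
    FourierBound (∑ i ∈ s, B i) (fun χ => ∑ i ∈ s, F i χ) := by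
  have := tsum (ι := s) (F := fun i => F i) (B := fun i => B i) (fun i => hF i i.2)
    Summable.of_finite
  simpa only [tsum_fintype, Finset.univ_eq_attach, Finset.sum_attach s B,
    fun χ => Finset.sum_attach s (fun i => F i χ)] using this

theorem add (hf : FourierBound M f) (hg : FourierBound N g) :
    FourierBound (M + N) (fun χ => f χ + g χ) := by
  have := sum (Finset.univ : Finset (Fin 2)) (F := ![f, g]) (B := ![M, N]) (by
    simp [Fin.forall_fin_two, hf, hg])
  simpa using this

theorem mul (hf : FourierBound M f) (hg : FourierBound N g) :
    FourierBound (M * N) (fun χ => f χ * g χ) := by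
  have hM0 := hf.nonneg
  obtain ⟨c, hc, hM, e⟩ := hf
  obtain ⟨c', hc', hM', e'⟩ := hg
  refine of_family (fun p : G × G => c p.1 * c' p.2) (fun p => p.1 + p.2) ?_ ?_ fun χ => ?_
  · simpa using hc.mul_of_nonneg hc' (fun _ => norm_nonneg _) fun _ => norm_nonneg _
  · have := tsum_mul_tsum_of_summable_norm (f := fun u => ‖c u‖) (g := fun u => ‖c' u‖)
      (by simpa using hc) (by simpa using hc')
    simp only [norm_mul]
    rw [← this]
    exact mul_le_mul hM hM' (tsum_nonneg fun _ => norm_nonneg _) hM0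
  · rw [e, e', tsum_mul_tsum_of_summable_norm (summable_norm_mul_char hc _)
      (summable_norm_mul_char hc' _)]
    refine tsum_congr fun p => ?_
    rw [AddChar.map_add_eq_mul, Circle.coe_mul]
    ring

theorem const_mul (a : ℂ) (hf : FourierBound M f) : FourierBound (‖a‖ * M) (fun χ => a * f χ) :=
  (const a).mul hf

theorem neg (hf : FourierBound M f) : FourierBound M (fun χ => -f χ) := by
  simpa using hf.const_mul (-1)

theorem sub (hf : FourierBound M f) (hg : FourierBound N g) :
    FourierBound (M + N) (fun χ => f χ - g χ) := by
  simpa [sub_eq_add_neg] using hf.add hg.neg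

theorem pow (hf : FourierBound M f) (n : ℕ) : FourierBound (M ^ n) (fun χ => f χ ^ n) := by
  induction n with
  | zero => simpa using const (G := G) 1
  | succ n ih => simpa [pow_succ] using ih.mul hf

theorem exp (hf : FourierBound M f) :
    FourierBound (Real.exp M) (fun χ => Complex.exp (f χ)) := by
  have := tsum (fun n : ℕ => (hf.pow n).const_mul ((n.factorial : ℂ)⁻¹)) (by
    simpa [div_eq_inv_mul] using Real.summable_pow_div_factorial M)
  simpa [Real.exp_eq_exp_ℝ, Complex.exp_eq_exp_ℂ, NormedSpace.exp_eq_tsum_div, div_eq_inv_mul]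
    using this

theorem conj (hf : FourierBound M f) :
    FourierBound M (fun χ => (starRingEnd ℂ) (f χ)) := by
  obtain ⟨c, hc, hM, e⟩ := hf
  refine of_family (fun u => (starRingEnd ℂ) (c u)) (fun u => -u) (by simpa using hc)
    (by simpa using hM) fun χ => ?_
  rw [e, Complex.conj_tsum]
  refine tsum_congr fun u => ?_
  rw [map_mul, AddChar.map_neg_eq_inv, Circle.coe_inv_eq_conj]

/-- Pushforward of a Fourier series along a homomorphism of the frequency groups. -/
theorem comp (hf : FourierBound M f) (φ : G →+ H) :
    FourierBound M (fun χ : AddChar H Circle => f (χ.compAddMonoidHom φ)) := by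
  obtain ⟨c, hc, hM, e⟩ := hf
  exact of_family c φ hc hM fun χ => by rw [e]; rfl

/-- Every element of `ℓ¹(G)` is a limit of finitely supported ones. -/
theorem exists_finset_sum (hf : FourierBound M f) {ε : ℝ} (hε : 0 < ε) :
    ∃ (s : Finset G) (c : G → ℂ),
      FourierBound ε (fun χ => f χ - ∑ u ∈ s, c u * (χ u : ℂ)) := by
  obtain ⟨c, hc, -, e⟩ := hf
  obtain ⟨s, hs⟩ := ((tendsto_order.1 (tendsto_tsum_compl_atTop_zero fun u => ‖c u‖)).2 ε hε).exists
  refine ⟨s, c, of_family (fun u : {u // u ∉ s} => c u) (fun u => u) (hc.subtype _) hs.le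
    fun χ => ?_⟩
  rw [e, sub_eq_iff_eq_add',
    (summable_norm_mul_char hc fun v => χ v).of_norm.sum_add_tsum_subtype_compl s]

/-! ### The spectral radius of powers -/

/-- A set `D` of characters of `G` *separates by signs* if every nonzero element of `G` takes the
value `-1` at some character in `D`. -/
def SignSeparating (D : Set (AddChar G Circle)) : Prop :=
  ∀ u : G, u ≠ 0 → ∃ χ ∈ D, (χ u : ℂ) = -1

/-- The coefficients of a trigonometric polynomial are bounded by its supremum over `D`. If `τ ∈ D`
has `τ (w - u) = -1`, then averaging `p` with its translate by `τ`, twisted by `τ u`, keeps the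
`u`-coefficient and removes the frequency `w` without increasing the supremum. -/
theorem norm_coeff_le (D : Submonoid (AddChar G Circle))
    (hD : SignSeparating (D : Set (AddChar G Circle))) (s : Finset G) :
    ∀ (c : G → ℂ) (u : G), u ∉ s →
      (∀ χ ∈ D, ‖c u * (χ u : ℂ) + ∑ v ∈ s, c v * (χ v : ℂ)‖ ≤ M) → ‖c u‖ ≤ M := by
  classical
  induction s using Finset.induction_on with
  | empty =>
    intro c u _ h
    simpa using h 1 D.one_mem
  | insert w s hw ih =>
    intro c u hu h
    have huw : u ≠ w := fun e => hu (by simp [e])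
    have hus : u ∉ s := fun e => hu (by simp [e])
    obtain ⟨τ, hτ, hτw⟩ := hD (w - u) (sub_ne_zero.2 huw.symm)
    have hτw' : (τ w : ℂ) = -(τ u : ℂ) := by
      have : τ w = τ (w - u) * τ u := by rw [← AddChar.map_add_eq_mul, sub_add_cancel]
      rw [this, Circle.coe_mul, hτw, neg_one_mul]
    have hτu : (τ u : ℂ) ≠ 0 := Circle.coe_ne_zero _
    have key := ih (fun v => c v * ((1 + (τ v : ℂ) / (τ u : ℂ)) / 2)) u hus (fun χ hχ => by
      have h1 := h χ hχ
      have h2 := h (χ * τ) (D.mul_mem hχ hτ)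
      have e : c u * ((1 + (τ u : ℂ) / (τ u : ℂ)) / 2) * (χ u : ℂ) +
          ∑ v ∈ s, c v * ((1 + (τ v : ℂ) / (τ u : ℂ)) / 2) * (χ v : ℂ) =
          ((c u * (χ u : ℂ) + ∑ v ∈ insert w s, c v * (χ v : ℂ)) +
          (τ u : ℂ)⁻¹ * (c u * ((χ * τ) u : ℂ) + ∑ v ∈ insert w s, c v * ((χ * τ) v : ℂ))) / 2 := by
        rw [Finset.sum_insert hw, Finset.sum_insert hw]
        simp only [AddChar.mul_apply, Circle.coe_mul, hτw', mul_add, Finset.mul_sum, add_div,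
          Finset.sum_div]
        have : ∑ v ∈ s, c v * (1 / 2 + (τ v : ℂ) / (τ u : ℂ) / 2) * (χ v : ℂ) =
            ∑ v ∈ s, c v * (χ v : ℂ) / 2 +
            ∑ v ∈ s, (τ u : ℂ)⁻¹ * (c v * ((χ v : ℂ) * (τ v : ℂ))) / 2 := by
          rw [← Finset.sum_add_distrib]
          exact Finset.sum_congr rfl fun v _ => by ring
        rw [← Finset.sum_div] at this ⊢
        simp only [add_mul, mul_add] at this ⊢
        rw [this]
        field_simp
        ring
      rw [e, norm_div, Complex.norm_ofNat, div_le_iff₀ two_pos]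
      refine (norm_add_le _ _).trans ?_
      rw [norm_mul, norm_inv, Circle.norm_coe, inv_one, one_mul]
      linarith)
    rwa [div_self hτu, one_add_one_eq_two, div_self two_ne_zero, mul_one] at key

/-- The norm in `ℓ¹(G)` of a trigonometric polynomial is at most its number of terms times its
supremum over `D`. -/
theorem of_finset_sum (D : Submonoid (AddChar G Circle))
    (hD : SignSeparating (D : Set (AddChar G Circle))) {ι : Type*} (T : Finset ι)
    (c : ι → ℂ) (u : ι → G) (h : ∀ χ ∈ D, ‖∑ i ∈ T, c i * (χ (u i) : ℂ)‖ ≤ M) :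
    FourierBound (T.card * M) (fun χ => ∑ i ∈ T, c i * (χ (u i) : ℂ)) := by
  classical
  have hM : 0 ≤ M := (norm_nonneg _).trans (h 1 D.one_mem)
  let a : G → ℂ := fun v => ∑ i ∈ T with u i = v, c i
  have e : ∀ χ : AddChar G Circle,
      ∑ i ∈ T, c i * (χ (u i) : ℂ) = ∑ v ∈ T.image u, a v * (χ v : ℂ) := fun χ => by
    rw [← Finset.sum_fiberwise_of_maps_to (fun i hi => Finset.mem_image_of_mem u hi)]
    refine Finset.sum_congr rfl fun v _ => ?_
    rw [Finset.sum_mul]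
    exact Finset.sum_congr rfl fun i hi => by rw [(Finset.mem_filter.1 hi).2]
  simp only [e] at h ⊢
  have ha : ∀ v ∈ T.image u, ‖a v‖ ≤ M := fun v hv => by
    refine norm_coeff_le D hD ((T.image u).erase v) a v (Finset.notMem_erase _ _) fun χ hχ => ?_
    rw [Finset.add_sum_erase _ (fun v => a v * (χ v : ℂ)) hv]
    exact h χ hχ
  refine (sum (T.image u) fun v _ => monomial (a v) v).mono ?_
  refine (Finset.sum_le_card_nsmul _ _ _ ha).trans ?_
  rw [nsmul_eq_mul]
  gcongr
  exact Finset.card_image_le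

/-- Since the frequencies of `p ^ n` are combinations `∑ kᵢ uᵢ` with `∑ kᵢ = n`, their number, and
hence the norm of `p ^ n` relative to its supremum, grows only polynomially in `n`. -/
theorem pow_finset_sum (D : Submonoid (AddChar G Circle))
    (hD : SignSeparating (D : Set (AddChar G Circle))) {ι : Type*} [Fintype ι]
    (c : ι → ℂ) (u : ι → G) (h : ∀ χ ∈ D, ‖∑ i, c i * (χ (u i) : ℂ)‖ ≤ M) (n : ℕ) :
    FourierBound (((n : ℝ) + 1) ^ Fintype.card ι * M ^ n)
      (fun χ => (∑ i, c i * (χ (u i) : ℂ)) ^ n) := by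
  classical
  have hM : 0 ≤ M := (norm_nonneg _).trans (h 1 D.one_mem)
  have e : ∀ χ : AddChar G Circle, (∑ i, c i * (χ (u i) : ℂ)) ^ n =
      ∑ k ∈ Finset.piAntidiag Finset.univ n,
        ((Nat.multinomial Finset.univ k : ℂ) * ∏ i, c i ^ k i) * (χ (∑ i, k i • u i) : ℂ) := by
    intro χ
    rw [Finset.sum_pow_eq_sum_piAntidiag]
    refine Finset.sum_congr rfl fun k _ => ?_
    have hχ : (χ (∑ i, k i • u i) : ℂ) = ∏ i, (χ (u i) : ℂ) ^ k i := by
      refine (map_prod (Circle.coeHom.comp χ.toMonoidHom)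
        (fun i => Multiplicative.ofAdd (k i • u i)) Finset.univ).trans ?_
      refine Finset.prod_congr rfl fun i _ => ?_
      change (χ (k i • u i) : ℂ) = _
      rw [AddChar.map_nsmul_eq_pow, Circle.coe_pow]
    rw [hχ, mul_assoc, ← Finset.prod_mul_distrib]
    simp only [mul_pow]
  have hcard : (Finset.piAntidiag (Finset.univ : Finset ι) n).card ≤ (n + 1) ^ Fintype.card ι := by
    refine (Finset.card_le_card (t := Fintype.piFinset fun _ : ι => Finset.range (n + 1))
      fun k hk => ?_).trans (by simp)
    rw [Finset.mem_piAntidiag] at hk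
    refine Fintype.mem_piFinset.2 fun i => Finset.mem_range.2 (Nat.lt_succ_of_le ?_)
    rw [← hk.1]
    exact Finset.single_le_sum (fun _ _ => Nat.zero_le _) (Finset.mem_univ i)
  have := of_finset_sum (M := M ^ n) D hD (Finset.piAntidiag Finset.univ n)
    (fun k => (Nat.multinomial Finset.univ k : ℂ) * ∏ i, c i ^ k i) (fun k => ∑ i, k i • u i)
    (fun χ hχ => by
      rw [← e, norm_pow]
      exact pow_le_pow_left₀ (norm_nonneg _) (h χ hχ) n)
  simp only [e]
  refine this.mono ?_
  gcongr
  exact_mod_cast hcard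

/-- The spectral radius in `ℓ¹(G)` is at most the supremum over `D`: if that supremum is less
than `1`, the norms of the powers are summable. -/
theorem exists_summable_pow (D : Submonoid (AddChar G Circle))
    (hD : SignSeparating (D : Set (AddChar G Circle))) (hf : FourierBound M f)
    (hs : s < 1) (h : ∀ χ ∈ D, ‖f χ‖ ≤ s) :
    ∃ B : ℕ → ℝ, Summable B ∧ ∀ n, FourierBound (B n) (fun χ => f χ ^ n) := by
  have hs0 : 0 ≤ s := (norm_nonneg _).trans (h 1 D.one_mem)
  obtain ⟨ε, hε, hε1⟩ : ∃ ε > 0, s + 2 * ε < 1 := ⟨(1 - s) / 4, by linarith, by linarith⟩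
  obtain ⟨S, c, hr⟩ := hf.exists_finset_sum hε
  have hp : ∀ χ ∈ D, ‖∑ i : S, c i * (χ i : ℂ)‖ ≤ s + ε := fun χ hχ => by
    rw [Finset.sum_coe_sort S fun i => c i * (χ i : ℂ)]
    have := norm_sub_le (f χ) (f χ - ∑ u ∈ S, c u * (χ u : ℂ))
    rw [sub_sub_cancel] at this
    linarith [h χ hχ, hr.norm_le χ]
  have hpow := pow_finset_sum D hD (fun i : S => c i) (fun i : S => (i : G)) hp
  -- Write `f = p + r` with `p` a polynomial bounded by `s + ε` on `D` and `r` of norm at most `ε`;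
  -- the binomial formula for `(p + r) ^ n` then gives the bound `(n + 1) ^ k * (s + 2 * ε) ^ n`.
  refine ⟨fun n => ((n : ℝ) + 1) ^ Fintype.card S * (s + 2 * ε) ^ n, ?_, fun n => ?_⟩
  · have h1 : ‖s + 2 * ε‖ < 1 := by rwa [Real.norm_of_nonneg (by positivity)]
    have h2 : Summable fun n : ℕ =>
        ((n + 1 : ℕ) : ℝ) ^ Fintype.card S * (s + 2 * ε) ^ (n + 1) :=
      (summable_pow_mul_geometric_of_norm_lt_one (Fintype.card S) h1).comp_injective
        (add_left_injective 1)
    refine (h2.mul_left (s + 2 * ε)⁻¹).congr fun n => ?_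
    have : s + 2 * ε ≠ 0 := by positivity
    push_cast
    field_simp
    exact pow_succ' _ _
  · have e : ∀ χ : AddChar G Circle, f χ ^ n = ∑ j ∈ Finset.range (n + 1),
        (∑ i : S, c i * (χ i : ℂ)) ^ j * (f χ - ∑ u ∈ S, c u * (χ u : ℂ)) ^ (n - j) *
          (n.choose j : ℂ) := fun χ => by
      rw [← add_pow, Finset.sum_coe_sort S fun i => c i * (χ i : ℂ), add_sub_cancel]
    simp only [e]
    refine (sum _ fun j _ => ((hpow j).mul (hr.pow (n - j))).mul (const _)).mono ?_
    calc ∑ j ∈ Finset.range (n + 1), ((j : ℝ) + 1) ^ Fintype.card S * (s + ε) ^ j * ε ^ (n - j) *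
          ‖(n.choose j : ℂ)‖
        ≤ ∑ j ∈ Finset.range (n + 1), ((n : ℝ) + 1) ^ Fintype.card S *
          ((s + ε) ^ j * ε ^ (n - j) * (n.choose j : ℝ)) := by
          refine Finset.sum_le_sum fun j hj => ?_
          have hj' : (j : ℝ) ≤ n := by
            exact_mod_cast Nat.le_of_lt_succ (Finset.mem_range.1 hj)
          rw [Complex.norm_natCast, mul_assoc, mul_assoc, ← mul_assoc ((s + ε) ^ j)]
          gcongr
      _ = ((n : ℝ) + 1) ^ Fintype.card S * (s + 2 * ε) ^ n := by
          rw [← Finset.mul_sum, ← add_pow]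
          ring_nf

/-! ### Nonvanishing and logarithms -/

/-- Kronecker's theorem, in the form: an absolutely convergent Fourier series has the same supremum
over `D` as over the whole dual group. -/
theorem norm_le_of_forall_mem (D : Submonoid (AddChar G Circle))
    (hD : SignSeparating (D : Set (AddChar G Circle))) (hf : FourierBound M f)
    (h : ∀ χ ∈ D, ‖f χ‖ ≤ s) (χ : AddChar G Circle) : ‖f χ‖ ≤ s := by
  by_contra! hlt
  have hs0 : 0 ≤ s := (norm_nonneg _).trans (h 1 D.one_mem)
  have hpos : 0 < ‖f χ‖ := hs0.trans_lt hlt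
  obtain ⟨B, hB, hpow⟩ := exists_summable_pow D hD (hf.const_mul (f χ)⁻¹)
    ((div_lt_one hpos).2 hlt) fun ψ hψ => by
      rw [norm_mul, norm_inv, div_eq_inv_mul]
      exact mul_le_mul_of_nonneg_left (h ψ hψ) (by positivity)
  have : ∀ n, 1 ≤ B n := fun n => by
    simpa [inv_mul_cancel₀ (norm_pos_iff.1 hpos)] using (hpow n).norm_le χ
  exact absurd (ge_of_tendsto' hB.tendsto_atTop_zero this) (by norm_num)

/-- If `f` is bounded away from zero on `D`, then it has no zero on the dual group: otherwise
`C ^ 2 - |f| ^ 2` would be larger at that zero than anywhere on `D`. -/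
theorem ne_zero_of_forall_mem (D : Submonoid (AddChar G Circle))
    (hD : SignSeparating (D : Set (AddChar G Circle))) (hf : FourierBound M f)
    (hδ : 0 < δ) (h : ∀ χ ∈ D, δ ≤ ‖f χ‖) (χ : AddChar G Circle) : f χ ≠ 0 := by
  intro h0
  -- The constant `C` is the norm bound `M`, which dominates `‖f ψ‖` at every character.
  have hn : ∀ ψ, ‖((M ^ 2 : ℝ) : ℂ) - f ψ * (starRingEnd ℂ) (f ψ)‖ = M ^ 2 - ‖f ψ‖ ^ 2 := by
    intro ψ
    rw [Complex.mul_conj, Complex.normSq_eq_norm_sq, ← Complex.ofReal_sub, Complex.norm_real,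
      Real.norm_of_nonneg]
    have := pow_le_pow_left₀ (norm_nonneg _) (hf.norm_le ψ) 2
    linarith
  have := norm_le_of_forall_mem (s := M ^ 2 - δ ^ 2) D hD
    ((const ((M ^ 2 : ℝ) : ℂ)).sub (hf.mul hf.conj)) (fun ψ hψ => by
      rw [hn]
      have := pow_le_pow_left₀ hδ.le (h ψ hψ) 2
      linarith) χ
  rw [hn, h0, norm_zero] at this
  nlinarith

/-- A logarithm near `1`: the Taylor series of `log (1 + z)` converges in `ℓ¹(G)` as soon as the
supremum over `D` is less than `1`. -/
theorem exists_exp_eq_one_add (D : Submonoid (AddChar G Circle))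
    (hD : SignSeparating (D : Set (AddChar G Circle))) (hf : FourierBound M f)
    (hs : s < 1) (h : ∀ χ ∈ D, ‖f χ‖ ≤ s) :
    ∃ (N : ℝ) (g : AddChar G Circle → ℂ), FourierBound N g ∧ ∀ χ, Complex.exp (g χ) = 1 + f χ := by
  obtain ⟨B, hB, hpow⟩ := exists_summable_pow D hD hf hs h
  have hlt : ∀ χ, ‖f χ‖ < 1 := fun χ => (norm_le_of_forall_mem D hD hf h χ).trans_lt hs
  refine ⟨∑' n, B n, fun χ => Complex.log (1 + f χ), ?_, fun χ => Complex.exp_log ?_⟩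
  · have := tsum (fun n : ℕ => ((hpow n).const_mul ((-1) ^ (n + 1) / n)).mono (N := B n) (by
      refine mul_le_of_le_one_left (hpow n).nonneg ?_
      rcases n.eq_zero_or_pos with rfl | hn
      · simp
      · simpa using inv_le_one_of_one_le₀ (by exact_mod_cast hn : (1 : ℝ) ≤ n))) hB
    convert this using 2 with χ
    rw [← (Complex.hasSum_taylorSeries_log (hlt χ)).tsum_eq]
    exact tsum_congr fun n => by ring
  · intro h0
    have := hlt χ
    rw [eq_neg_of_add_eq_zero_right h0] at this
    simp at this

end FourierBound

/-! ### Logarithms on the torus -/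

/-- Every nowhere vanishing continuous function on the torus is a monomial times the exponential of
a continuous function. Its pull-back to `ℝⁿ` has a continuous logarithm `F`; the increment of `F`
along the `j`-th period is a constant `2πi mⱼ`, and subtracting the linear function with these
increments makes `F` periodic. -/
theorem UnitAddTorus.exists_eq_mFourier_mul_exp {ι : Type*} [Fintype ι]
    (P : C(UnitAddTorus ι, ℂ)) (hP : ∀ x, P x ≠ 0) :
    ∃ (m : ι → ℤ) (g : C(UnitAddTorus ι, ℂ)),
      ∀ x, P x = UnitAddTorus.mFourier m x * Complex.exp (g x) := by
  classical
  let q : (ι → ℝ) → UnitAddTorus ι := Pi.map fun _ x => (x : UnitAddCircle)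
  have hq : IsOpenQuotientMap q := IsOpenQuotientMap.piMap fun _ =>
    (QuotientAddGroup.isOpenQuotientMap_mk)
  obtain ⟨F, ⟨-, hF⟩, -⟩ := Complex.isCoveringMapOn_exp.existsUnique_continuousMap_lifts
    (P.comp ⟨q, hq.continuous⟩) (a₀ := 0) (e₀ := Complex.log (P (q 0)))
    (Complex.exp_log (hP _)) (fun a => hP _)
  replace hF : ∀ x, Complex.exp (F x) = P (q x) := fun x => congrFun hF x
  have hper : ∀ (x : ι → ℝ) (j : ι), q (x + Pi.single j 1) = q x := by
    intro x j
    ext i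
    by_cases h : i = j
    · subst h
      simp [q]
    · simp [q, h]
  have hinc : ∀ j, ∃ k : ℤ, ∀ x, F (x + Pi.single j 1) = F x + k * (2 * Real.pi * Complex.I) := by
    intro j
    have hex : ∀ x, ∃ k : ℤ, F (x + Pi.single j 1) = F x + k * (2 * Real.pi * Complex.I) :=
      fun x => Complex.exp_eq_exp_iff_exists_int.1 (by rw [hF, hF, hper])
    choose k hk using hex
    have hkc : Continuous k := by
      rw [Int.isClosedEmbedding_coe_real.isInducing.continuous_iff]
      have : (Int.cast ∘ k : (ι → ℝ) → ℝ) =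
          fun x => ((F (x + Pi.single j 1) - F x) / (2 * Real.pi * Complex.I)).re := by
        ext x
        rw [hk, add_sub_cancel_left, mul_div_cancel_right₀ _ Complex.two_pi_I_ne_zero]
        simp
      rw [this]
      fun_prop
    exact ⟨k 0, fun x => by rw [hk, PreconnectedSpace.constant inferInstance hkc]⟩
  choose m hm using hinc
  let L : C(ι → ℝ, ℂ) :=
    ⟨fun x => F x - 2 * Real.pi * Complex.I * ∑ j, (m j : ℂ) * (x j : ℂ), by fun_prop⟩
  have hL : ∀ x, L x = F x - 2 * Real.pi * Complex.I * ∑ j, (m j : ℂ) * (x j : ℂ) := fun _ => rfl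
  let Λ : AddSubgroup (ι → ℝ) :=
    { carrier := {v | ∀ x, L (x + v) = L x}
      zero_mem' := fun x => by rw [add_zero]
      add_mem' := fun {v w} hv hw x => by rw [← add_assoc, hw, hv]
      neg_mem' := fun {v} hv x => by rw [← hv (x + -v), neg_add_cancel_right] }
  have hΛ : ∀ j, Pi.single j 1 ∈ Λ := by
    intro j x
    rw [hL, hL, hm]
    simp only [Pi.add_apply, Complex.ofReal_add, mul_add, Finset.sum_add_distrib]
    rw [Finset.sum_eq_single j (f := fun i => (m i : ℂ) * ((Pi.single j (1 : ℝ) : ι → ℝ) i : ℂ))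
      (fun i _ h => by simp [h]) (by simp)]
    simp
    ring
  have hfac : ∀ x y, q x = q y → L x = L y := by
    intro x y hxy
    have hz : ∀ i, ∃ z : ℤ, z • (1 : ℝ) = y i - x i := fun i => by
      have := congrFun hxy i
      exact AddSubgroup.mem_zmultiples_iff.1 (QuotientAddGroup.eq_iff_sub_mem.1 this.symm)
    choose z hz using hz
    have hmem : y - x ∈ Λ := by
      have : y - x = ∑ j, z j • Pi.single j (1 : ℝ) := by
        ext i
        rw [Finset.sum_apply, Finset.sum_eq_single i (fun j _ h => by simp [h.symm]) (by simp)]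
        rw [Pi.sub_apply, ← hz i]
        simp
      rw [this]
      exact Λ.sum_mem fun j _ => Λ.zsmul_mem (hΛ j) _
    have := hmem x
    rw [add_sub_cancel] at this
    exact this.symm
  have hq' : Topology.IsQuotientMap (⟨q, hq.continuous⟩ : C(ι → ℝ, UnitAddTorus ι)) :=
    hq.isQuotientMap
  have hfac' : Function.FactorsThrough L (⟨q, hq.continuous⟩ : C(ι → ℝ, UnitAddTorus ι)) :=
    fun x y h => hfac x y h
  refine ⟨m, hq'.lift L hfac', fun x => ?_⟩
  obtain ⟨x, rfl⟩ := hq.surjective x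
  have h1 : hq'.lift L hfac' (q x) = L x := congr($(hq'.lift_comp L hfac') x)
  have h2 : UnitAddTorus.mFourier m (q x) =
      Complex.exp (2 * Real.pi * Complex.I * ∑ j, (m j : ℂ) * (x j : ℂ)) := by
    change ∏ i, fourier (m i) (x i : UnitAddCircle) = _
    rw [Finset.mul_sum, Complex.exp_sum]
    refine Finset.prod_congr rfl fun i _ => ?_
    rw [fourier_coe_apply]
    congr 1
    simp
    ring
  rw [h1, h2, ← Complex.exp_add, hL, add_sub_cancel, hF]

/-- In terms of a `ℤ`-basis of `G`, the characters of `G` are the points of the torus. -/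
theorem AddChar.exists_eq_mFourier {G ι : Type*} [AddCommGroup G] [Fintype ι]
    (b : Module.Basis ι ℤ G) (χ : AddChar G Circle) :
    ∃ x : UnitAddTorus ι, ∀ u, (χ u : ℂ) = UnitAddTorus.mFourier (b.repr u) x := by
  choose x hx using fun j =>
    (AddCircle.homeomorphCircle (one_ne_zero (α := ℝ))).surjective (χ (b j))
  refine ⟨x, fun u => ?_⟩
  have hu : (χ u : ℂ) = ∏ j, ((χ (b j) ^ (b.repr u j) : Circle) : ℂ) := by
    conv_lhs => rw [← b.sum_repr u]
    refine (map_prod (Circle.coeHom.comp χ.toMonoidHom)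
      (fun i => Multiplicative.ofAdd (b.repr u i • b i)) Finset.univ).trans ?_
    refine Finset.prod_congr rfl fun i _ => ?_
    change (χ (b.repr u i • b i) : ℂ) = _
    rw [AddChar.map_zsmul_eq_zpow]
  rw [hu]
  refine Finset.prod_congr rfl fun j _ => ?_
  rw [fourier_apply, AddCircle.toCircle_zsmul, ← hx, AddCircle.homeomorphCircle_apply]

/-- Conversely, every point of the torus is a character. -/
theorem UnitAddTorus.exists_addChar {G ι : Type*} [AddCommGroup G] [Fintype ι]
    (b : Module.Basis ι ℤ G) (x : UnitAddTorus ι) :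
    ∃ χ : AddChar G Circle, ∀ u, (χ u : ℂ) = UnitAddTorus.mFourier (b.repr u) x := by
  let χ : AddChar G Circle :=
    { toFun := fun u => ∏ j, AddCircle.toCircle ((b.repr u j) • x j)
      map_zero_eq_one' := by simp
      map_add_eq_mul' := fun u v => by
        simp [add_smul, AddCircle.toCircle_add, Finset.prod_mul_distrib] }
  refine ⟨χ, fun u => ?_⟩
  change Circle.coeHom (∏ j, AddCircle.toCircle ((b.repr u j) • x j)) = _
  rw [map_prod]
  rfl

namespace FourierBound

/-- On a free group of finite rank the dual is a torus, and a nowhere vanishing trigonometric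
polynomial is, up to a relative error `ε`, a character times the exponential of a trigonometric
polynomial. -/
theorem exists_log_approx_of_basis {F ι : Type*} [AddCommGroup F] [Fintype ι]
    (b : Module.Basis ι ℤ F) (S : Finset F) (c : F → ℂ)
    (hp : ∀ χ : AddChar F Circle, ∑ u ∈ S, c u * (χ u : ℂ) ≠ 0) {ε : ℝ} (hε : 0 < ε) :
    ∃ (γ : F) (M : ℝ) (g : AddChar F Circle → ℂ), FourierBound M g ∧
      ∀ χ : AddChar F Circle,
        ‖(∑ u ∈ S, c u * (χ u : ℂ)) * (χ (-γ) : ℂ) * Complex.exp (-g χ) - 1‖ ≤ ε := by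
  let P : C(UnitAddTorus ι, ℂ) := ∑ u ∈ S, c u • UnitAddTorus.mFourier (b.repr u)
  have hP : ∀ x, P x = ∑ u ∈ S, c u * UnitAddTorus.mFourier (b.repr u) x := fun x => by
    simp [P, ContinuousMap.sum_apply]
  obtain ⟨m, g, hg⟩ := UnitAddTorus.exists_eq_mFourier_mul_exp P (fun x => by
    obtain ⟨χ, hχ⟩ := UnitAddTorus.exists_addChar b x
    simpa [hP, hχ] using hp χ)
  obtain ⟨η, hη, hexp⟩ := Metric.continuousAt_iff.1
    (Complex.continuous_exp.continuousAt (x := 0)) ε hε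
  have hdense : g ∈ closure (Submodule.span ℂ (Set.range (UnitAddTorus.mFourier (d := ι))) :
      Set C(UnitAddTorus ι, ℂ)) := by
    rw [← Submodule.topologicalClosure_coe, UnitAddTorus.span_mFourier_closure_eq_top]
    trivial
  obtain ⟨k, hk, hgk⟩ := Metric.mem_closure_iff.1 hdense η hη
  obtain ⟨a, rfl⟩ := Finsupp.mem_span_range_iff_exists_finsupp.1 hk
  let e : (ι → ℤ) → F := fun l => b.equivFun.symm l
  have he : ∀ l, ⇑(b.repr (e l)) = l := fun l => b.equivFun.apply_symm_apply l
  refine ⟨e m, _, _, sum a.support (F := fun l χ => a l * (χ (e l) : ℂ))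
    fun l _ => monomial (a l) (e l), fun χ => ?_⟩
  obtain ⟨x, hx⟩ := AddChar.exists_eq_mFourier b χ
  have h1 : ∑ u ∈ S, c u * (χ u : ℂ) = (χ (e m) : ℂ) * Complex.exp (g x) := by
    simp only [hx, he, ← hP, hg]
  have h2 : ∑ l ∈ a.support, a l * (χ (e l) : ℂ) =
      (a.sum fun l z => z • UnitAddTorus.mFourier l) x := by
    simp [Finsupp.sum, ContinuousMap.sum_apply, hx, he]
  have h3 : (χ (e m) : ℂ) * (χ (-e m) : ℂ) = 1 := by
    rw [AddChar.map_neg_eq_inv, ← Circle.coe_mul, mul_inv_cancel, Circle.coe_one]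
  rw [h1, h2, mul_right_comm _ (Complex.exp (g x)), h3, one_mul, ← Complex.exp_add,
    ← sub_eq_add_neg]
  have := hexp (x := g x - (a.sum fun l z => z • UnitAddTorus.mFourier l) x) (by
    rw [dist_zero_right, ← dist_eq_norm]
    exact (ContinuousMap.dist_apply_le_dist x).trans_lt hgk)
  rw [Complex.exp_zero, dist_eq_norm] at this
  exact this.le

/-! ### Absolutely convergent Fourier series bounded away from zero -/

/-- Reduction to finite rank: only the subgroup generated by the frequencies matters. -/
theorem exists_log_approx {G : Type*} [AddCommGroup G] [IsAddTorsionFree G]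
    (D : Submonoid (AddChar G Circle)) (hD : SignSeparating (D : Set (AddChar G Circle)))
    (S : Finset G) (c : G → ℂ) {δ : ℝ} (hδ : 0 < δ)
    (hp : ∀ χ ∈ D, δ ≤ ‖∑ u ∈ S, c u * (χ u : ℂ)‖) {ε : ℝ} (hε : 0 < ε) :
    ∃ (γ : G) (M : ℝ) (g : AddChar G Circle → ℂ), FourierBound M g ∧
      ∀ χ : AddChar G Circle,
        ‖(∑ u ∈ S, c u * (χ u : ℂ)) * (χ (-γ) : ℂ) * Complex.exp (-g χ) - 1‖ ≤ ε := by
  classical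
  let F : Submodule ℤ G := Submodule.span ℤ (S : Set G)
  have : Module.Finite ℤ F := Module.Finite.span_finset ℤ S
  let φ : F →+ G := F.subtype.toAddMonoidHom
  let res : AddChar G Circle →* AddChar F Circle :=
    { toFun := fun χ => χ.compAddMonoidHom φ
      map_one' := rfl
      map_mul' := fun _ _ => rfl }
  have hDF : SignSeparating (D.map res : Set (AddChar F Circle)) := fun u hu => by
    obtain ⟨χ, hχ, h⟩ := hD u (by simpa using hu)
    exact ⟨res χ, ⟨χ, hχ, rfl⟩, h⟩
  let j : S ↪ F := ⟨fun u => ⟨u, Submodule.subset_span u.2⟩, fun u v h =>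
    Subtype.ext congr(($h : G))⟩
  let S' : Finset F := S.attach.map j
  have hS' : ∀ χ : AddChar G Circle,
      ∑ u ∈ S', c u * (res χ u : ℂ) = ∑ u ∈ S, c u * (χ u : ℂ) := fun χ => by
    rw [Finset.sum_map, ← Finset.sum_attach S]
    rfl
  obtain ⟨γ, M, g, hg, h⟩ := exists_log_approx_of_basis (Module.finBasis ℤ F) S' (fun u => c u)
    (ne_zero_of_forall_mem (D.map res) hDF (sum S' fun u _ => monomial (c u) u) hδ (by
      rintro _ ⟨χ, hχ, rfl⟩
      rw [hS']
      exact hp χ hχ)) hε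
  refine ⟨γ, M, _, hg.comp φ, fun χ => ?_⟩
  have := h (res χ)
  rw [hS'] at this
  exact this

/-- An absolutely convergent Fourier series that is bounded away from zero on `D` is a character
times the exponential of an absolutely convergent Fourier series. -/
theorem exists_eq_char_mul_exp {G : Type*} [AddCommGroup G] [IsAddTorsionFree G]
    (D : Submonoid (AddChar G Circle)) (hD : SignSeparating (D : Set (AddChar G Circle)))
    {M : ℝ} {f : AddChar G Circle → ℂ} (hf : FourierBound M f) {δ : ℝ} (hδ : 0 < δ)
    (h : ∀ χ ∈ D, δ ≤ ‖f χ‖) :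
    ∃ (γ : G) (N : ℝ) (g : AddChar G Circle → ℂ), FourierBound N g ∧
      ∀ χ, f χ = (χ γ : ℂ) * Complex.exp (g χ) := by
  obtain ⟨S, c, hr⟩ := hf.exists_finset_sum (ε := δ / 4) (by positivity)
  have hp : ∀ χ ∈ D, 3 * δ / 4 ≤ ‖∑ u ∈ S, c u * (χ u : ℂ)‖ := fun χ hχ => by
    have := norm_sub_norm_le (f χ) (f χ - ∑ u ∈ S, c u * (χ u : ℂ))
    rw [sub_sub_cancel] at this
    linarith [h χ hχ, hr.norm_le χ]
  obtain ⟨γ, M₁, g₁, hg₁, happ⟩ := exists_log_approx D hD S c (by positivity) hp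
    (ε := 1 / 4) (by norm_num)
  have hw : FourierBound (1 * Real.exp M₁)
      fun χ : AddChar G Circle => (χ (-γ) : ℂ) * Complex.exp (-g₁ χ) := by
    simpa using (monomial 1 (-γ)).mul hg₁.neg.exp
  -- On `D` the quotient `f / (χ γ * exp g₁)` stays within `1 / 4 + 5 / 4 * 1 / 3 = 2 / 3` of `1`.
  obtain ⟨N, g₂, hg₂, he⟩ := exists_exp_eq_one_add (s := 2 / 3) D hD
    ((hf.mul hw).sub (const 1)) (by norm_num) (fun χ hχ => by
      set p := ∑ u ∈ S, c u * (χ u : ℂ) with hpdef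
      set w := (χ (-γ) : ℂ) * Complex.exp (-g₁ χ) with hwdef
      have h1 : ‖p * w - 1‖ ≤ 1 / 4 := by
        have := happ χ
        rwa [mul_assoc] at this
      have h2 : ‖p‖ * ‖w‖ ≤ 5 / 4 := by
        rw [← norm_mul]
        have := norm_add_le (p * w - 1) 1
        rw [sub_add_cancel, norm_one] at this
        linarith
      have h3 : ‖(f χ - p) * w‖ ≤ 5 / 12 := by
        rw [norm_mul]
        have h4 := mul_le_mul_of_nonneg_right (hr.norm_le χ) (norm_nonneg w)
        have h5 := mul_le_mul_of_nonneg_right (hp χ hχ) (norm_nonneg w)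
        rw [← hpdef] at h4 h5
        linarith
      calc ‖f χ * w - 1‖ = ‖(p * w - 1) + (f χ - p) * w‖ := by ring_nf
        _ ≤ 2 / 3 := by linarith [norm_add_le (p * w - 1) ((f χ - p) * w)])
  refine ⟨γ, _, _, hg₁.add hg₂, fun χ => ?_⟩
  have h3 : (χ γ : ℂ) * (χ (-γ) : ℂ) = 1 := by
    rw [AddChar.map_neg_eq_inv, ← Circle.coe_mul, mul_inv_cancel, Circle.coe_one]
  rw [Complex.exp_add, he, Complex.exp_neg]
  field_simp [Complex.exp_ne_zero]
  linear_combination (-f χ) * h3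

end FourierBound

/-! ### Characters given by the inner product -/

/-- The character `u ↦ e^{i⟨t, u⟩}` of an additive subgroup `G` of a real
inner product space. -/
noncomputable def expInnerChar {E : Type*} [NormedAddCommGroup E] [InnerProductSpace ℝ E]
    (G : Submodule ℤ E) (t : E) : AddChar G Circle where
  toFun u := Circle.exp (inner ℝ t (u : E))
  map_zero_eq_one' := by simp
  map_add_eq_mul' u v := by simp [inner_add_right]

section

variable {E : Type*} [NormedAddCommGroup E] [InnerProductSpace ℝ E] (G : Submodule ℤ E)

theorem expInnerChar_apply (t : E) (u : G) :
    (expInnerChar G t u : ℂ) = Complex.exp (Complex.I * (inner ℝ t (u : E) : ℝ)) := by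
  rw [mul_comm]
  exact Circle.coe_exp _

theorem expInnerChar_zero : expInnerChar G 0 = 1 := by
  ext u
  simp [expInnerChar]

theorem expInnerChar_add (s t : E) :
    expInnerChar G (s + t) = expInnerChar G s * expInnerChar G t := by
  ext u
  simp [expInnerChar, inner_add_left]

/-- The group of all characters `u ↦ e^{i⟨t, u⟩}`. -/
noncomputable def expInnerChars : Submonoid (AddChar G Circle) where
  carrier := Set.range (expInnerChar G)
  one_mem' := ⟨0, expInnerChar_zero G⟩
  mul_mem' := by
    rintro _ _ ⟨s, rfl⟩ ⟨t, rfl⟩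
    exact ⟨s + t, expInnerChar_add G s t⟩

theorem signSeparating_expInnerChars :
    FourierBound.SignSeparating (expInnerChars G : Set (AddChar G Circle)) := by
  intro u hu
  have hu' : (inner ℝ (u : E) (u : E) : ℝ) ≠ 0 := by simpa using hu
  refine ⟨_, ⟨(Real.pi / inner ℝ (u : E) (u : E)) • (u : E), rfl⟩, ?_⟩
  rw [expInnerChar_apply, real_inner_smul_left, div_mul_cancel₀ _ hu', mul_comm,
    Complex.exp_pi_mul_I]

end

/-! ### Trigonometric series on Euclidean space -/

/-- The group `coordSpan Y`, with its group structure. -/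
def coordSpanSubmodule {d : ℕ} (Y : Set (EuclideanSpace ℝ (Fin d))) :
    Submodule ℤ (EuclideanSpace ℝ (Fin d)) where
  carrier := coordSpan Y
  zero_mem' := fun j => Submodule.zero_mem _
  add_mem' := fun ha hb j => Submodule.add_mem _ (ha j) (hb j)
  smul_mem' := fun n _ ha j => by
    simpa using Submodule.smul_mem _ n (ha j)

theorem subset_coordSpan {d : ℕ} (Y : Set (EuclideanSpace ℝ (Fin d))) : Y ⊆ coordSpan Y :=
  fun y hy _ => Submodule.subset_span ⟨y, hy, rfl⟩

theorem theorem5 {d : ℕ} (Y : Set (EuclideanSpace ℝ (Fin d)))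
    (hY_ne : Y.Nonempty) (hY_count : Y.Countable)
    (q : Y → ℂ) (hq : Summable fun y : Y => ‖q y‖)
    (h : EuclideanSpace ℝ (Fin d) → ℂ)
    (h_def : ∀ t : EuclideanSpace ℝ (Fin d),
      h t = ∑' y : Y, q y *
        Complex.exp (Complex.I * (inner ℝ t (y : EuclideanSpace ℝ (Fin d)) : ℝ)))
    (h_zero : h 0 = 1)
    (h_inf : 0 < ⨅ t : EuclideanSpace ℝ (Fin d), ‖h t‖) :
    ∃ γ ∈ coordSpan Y, ∃ lam : ↥(coordSpan Y \ {0}) → ℂ,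
      Summable (fun u => ‖lam u‖) ∧
      ∀ t : EuclideanSpace ℝ (Fin d),
        h t = Complex.exp (Complex.I * (inner ℝ t γ : ℝ) +
          ∑' u : ↥(coordSpan Y \ {0}), lam u *
            (Complex.exp (Complex.I * (inner ℝ t (u : EuclideanSpace ℝ (Fin d)) : ℝ)) - 1)) := by
  let G := coordSpanSubmodule Y
  let f : AddChar G Circle → ℂ := fun χ => ∑' y : Y, q y * (χ ⟨y, subset_coordSpan Y y.2⟩ : ℂ)
  have hf : FourierBound (∑' y, ‖q y‖) f :=
    FourierBound.of_family q (fun y => ⟨y, subset_coordSpan Y y.2⟩) hq le_rfl fun _ => rfl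
  have hfh : ∀ t, f (expInnerChar G t) = h t := fun t => by
    rw [h_def]
    exact tsum_congr fun y => by rw [expInnerChar_apply]
  have : IsAddTorsionFree (EuclideanSpace ℝ (Fin d)) := IsAddTorsionFree.of_module_rat _
  have : IsAddTorsionFree G :=
    Function.Injective.isAddTorsionFree G.subtype.toAddMonoidHom Subtype.val_injective
  obtain ⟨γ, N, g, ⟨c, hc, -, hg⟩, hfg⟩ := FourierBound.exists_eq_char_mul_exp (expInnerChars G)
    (signSeparating_expInnerChars G) hf h_inf (by
      rintro _ ⟨t, rfl⟩
      rw [hfh]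
      exact ciInf_le ⟨0, by rintro _ ⟨t, rfl⟩; exact norm_nonneg _⟩ t)
  let ι : ↥(coordSpan Y \ {0}) → G := fun u => ⟨u, u.2.1⟩
  have hι : Function.Injective ι := fun u v e => Subtype.ext congr(($e : EuclideanSpace ℝ (Fin d)))
  refine ⟨γ, γ.2, fun u => c (ι u), hc.comp_injective hι, fun t => ?_⟩
  have hg0 : Complex.exp (g 1) = 1 := by
    have := hfg 1
    rw [← expInnerChar_zero, hfh, h_zero, expInnerChar_zero] at this
    simpa using this.symm
  have hsum : ∑' u : ↥(coordSpan Y \ {0}), c (ι u) *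
      (Complex.exp (Complex.I * (inner ℝ t (u : EuclideanSpace ℝ (Fin d)) : ℝ)) - 1) =
      g (expInnerChar G t) - g 1 := by
    have hs := fun χ : AddChar G Circle =>
      (FourierBound.summable_norm_mul_char hc fun u => χ u).of_norm
    rw [hg, hg, ← (hs _).tsum_sub (hs 1)]
    -- The frequency `0`, which is absent on the left, contributes `c 0 * (1 - 1)` on the right.
    rw [← hι.tsum_eq (f := fun u => c u * (expInnerChar G t u : ℂ) -
      c u * ((1 : AddChar G Circle) u : ℂ))]
    · refine tsum_congr fun u => ?_
      rw [expInnerChar_apply, AddChar.one_apply, Circle.coe_one, mul_sub]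
    · intro u hu
      refine ⟨⟨u, u.2, fun h0 => hu ?_⟩, rfl⟩
      have : u = 0 := Subtype.ext h0
      simp [this]
  rw [hsum, ← hfh, hfg, expInnerChar_apply, Complex.exp_add, Complex.exp_sub, hg0, div_one]
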